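/- Let $\ell \ge 2$ be an integer, and let $O_\ell$ be the Odd graph: its vertices are the $(\ell-1)$-subsets of a fixed $(2\ell-1)$-set, two of them being adjacent when they are disjoint. For a finite graph $G$ and an integer $k \ge 0$, let $\alpha_k(G)$ be the $k$-independence number of $G$, that is, the maximum size of a set of vertices of $G$ in which any two distinct vertices are at distance greater than $k$. Then $O_\ell$ has diameter $D = \ell-1$, and its $(D-1)$-independence number $\alpha_{D-1}(O_\ell) = \alpha_{\ell-2}(O_\ell)$ satisfies $$\alpha_{\ell-2}(O_\ell) \le \begin{cases} 2\ell-2 & \text{if } \ell \text{ is odd},\\ 2\ell-1 & \text{if } \ell \text{ is even}.\end{cases}$$ -/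

import Mathlib

open scoped Finset

/-- Vertices of the Odd graph `O_ℓ`: the `(ℓ - 1)`-subsets of a `(2ℓ - 1)`-set (for `ℓ ≥ 1`). -/
abbrev OddGraphVertex (ℓ : ℕ) : Type :=
  {A : Finset (Fin (2 * ℓ - 1)) // #A = ℓ - 1}

/-- The Odd graph `O_ℓ`: two vertices are adjacent when they are disjoint.
The clause `A ≠ B` matters only for `ℓ ≤ 1`, where the empty set is disjoint from itself. -/
def oddGraph (ℓ : ℕ) : SimpleGraph (OddGraphVertex ℓ) where
  Adj A B := A ≠ B ∧ Disjoint A.1 B.1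
  symm := ⟨fun _ _ h => ⟨h.1.symm, h.2.symm⟩⟩
  loopless := ⟨fun _ h => h.1 rfl⟩

namespace SimpleGraph

variable {V : Type*}

/-- `S` is `k`-independent in `G`: any two distinct vertices of `S` are at distance greater
than `k`. The distance is the extended one, infinite between different components. -/
def IsKIndepSet (G : SimpleGraph V) (k : ℕ) (S : Finset V) : Prop :=
  ∀ u ∈ S, ∀ v ∈ S, u ≠ v → (k : ℕ∞) < G.edist u v

open Classical in
/-- The `k`-independence number `α_k(G)` of a finite graph: the maximum size of a
`k`-independent set. -/
noncomputable def kIndepNum [Fintype V] (G : SimpleGraph V) (k : ℕ) : ℕ :=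
  (Finset.univ.filter fun S : Finset V => G.IsKIndepSet k S).sup Finset.card

end SimpleGraph

/-! Vertices `A`, `B` with `i` common points are at distance `min (2 * (ℓ - 1 - i)) (2 * i + 1)`.
Distance greater than `ℓ - 2` forces `i = (ℓ - 1) / 2` (`card_inter_of_lt_edist`), so an independent
set is a uniform family with constant pairwise intersection. Fisher's inequality bounds it by the `2
* ℓ - 1` points. For odd `ℓ` the constant function `1` is also independent of the indicators, which
saves one. -/

section Fisher

variable {α ι : Type*} [Fintype α] [DecidableEq α] [Fintype ι] [DecidableEq ι]

/-- The Gram identity for the indicators of a uniform family with constant pairwise intersection,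
together with the constant function `1`. -/
lemma sum_sq_sum_indicator_add_const {F : ι → Finset α} {k m : ℕ} (hk : ∀ i, #(F i) = k)
    (hm : ∀ i j, i ≠ j → #(F i ∩ F j) = m) (c : ι → ℝ) (d : ℝ) :
    ∑ x, (∑ i, c i * (if x ∈ F i then 1 else 0) + d) ^ 2 =
      (k - m) * ∑ i, c i ^ 2 + (m * (∑ i, c i) ^ 2 + 2 * d * k * ∑ i, c i
        + d ^ 2 * Fintype.card α) := by
  have h1 : ∑ x, ∑ i, c i * (if x ∈ F i then (1 : ℝ) else 0) = k * ∑ i, c i := by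
    rw [Finset.sum_comm, Finset.mul_sum]
    refine Finset.sum_congr rfl fun i _ => ?_
    simp [hk i, mul_comm]
  have h3 : ∀ i j, ∑ x, (if x ∈ F i then (1 : ℝ) else 0) * (if x ∈ F j then 1 else 0) =
      m + if i = j then (k - m : ℝ) else 0 := by
    intro i j
    have : ∑ x, (if x ∈ F i then (1 : ℝ) else 0) * (if x ∈ F j then 1 else 0)
        = #(F i ∩ F j) := by
      simp_rw [ite_zero_mul_ite_zero, mul_one, Finset.sum_boole]
      congr 2
      ext x
      simp
    rw [this]
    split_ifs with h
    · subst h; simp [hk i]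
    · simp [hm i j h]
  have h2 : ∑ x, (∑ i, c i * (if x ∈ F i then (1 : ℝ) else 0)) ^ 2 =
      (k - m) * ∑ i, c i ^ 2 + m * (∑ i, c i) ^ 2 := by
    calc _ = ∑ i, ∑ j, c i * c j *
          ∑ x, (if x ∈ F i then (1 : ℝ) else 0) * (if x ∈ F j then 1 else 0) := by
          simp_rw [pow_two, Finset.sum_mul_sum, Finset.mul_sum]
          rw [Finset.sum_comm]
          refine Finset.sum_congr rfl fun i _ => ?_
          rw [Finset.sum_comm]
          refine Finset.sum_congr rfl fun j _ => Finset.sum_congr rfl fun x _ => ?_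
          ring
      _ = _ := by
          simp_rw [h3, mul_add, Finset.sum_add_distrib]
          simp only [mul_ite, mul_zero, Finset.sum_ite_eq, Finset.mem_univ, if_true]
          rw [pow_two (∑ i, c i), Finset.sum_mul_sum, Finset.mul_sum, Finset.mul_sum, add_comm]
          simp_rw [Finset.mul_sum]
          congr 1
          · exact Finset.sum_congr rfl fun i _ => by ring
          · exact Finset.sum_congr rfl fun i _ => Finset.sum_congr rfl fun j _ => by ring
  simp_rw [add_sq, Finset.sum_add_distrib, h2, ← Finset.sum_mul, ← Finset.mul_sum, h1]
  simp
  ring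

lemma card_le_of_uniform_of_card_inter {F : ι → Finset α} {k m : ℕ} (hmk : m < k)
    (hk : ∀ i, #(F i) = k) (hm : ∀ i j, i ≠ j → #(F i ∩ F j) = m) :
    Fintype.card ι ≤ Fintype.card α := by
  have hli : LinearIndependent ℝ (fun i x => if x ∈ F i then (1 : ℝ) else 0) := by
    rw [Fintype.linearIndependent_iff]
    intro c hc
    have key := sum_sq_sum_indicator_add_const hk hm c 0
    have h0 : ∀ x, ∑ i, c i * (if x ∈ F i then (1 : ℝ) else 0) = 0 := fun x => by
      simpa using congrFun hc x
    simp only [h0] at key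
    have hpos : (0 : ℝ) < k - m := by simpa using hmk
    have hnn : (0 : ℝ) ≤ m * (∑ i, c i) ^ 2 := by positivity
    have hnn' : 0 ≤ ∑ i, c i ^ 2 := Finset.sum_nonneg fun i _ => sq_nonneg _
    have hs : ∑ i, c i ^ 2 = 0 := by
      simp at key
      nlinarith [mul_nonneg hpos.le hnn']
    intro i
    simpa using (Finset.sum_eq_zero_iff_of_nonneg fun i _ => sq_nonneg (c i)).1 hs i
  simpa using hli.fintype_card_le_finrank

/-- The condition `hkα` makes the remaining quadratic form in `∑ c` and `d` of the Gram identity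
positive semidefinite. -/
lemma card_lt_of_uniform_of_card_inter {F : ι → Finset α} {k m : ℕ} (hmk : m < k)
    (hk : ∀ i, #(F i) = k) (hm : ∀ i j, i ≠ j → #(F i ∩ F j) = m)
    (hα : 0 < Fintype.card α) (hkα : k ^ 2 ≤ m * Fintype.card α) :
    Fintype.card ι < Fintype.card α := by
  have hli : LinearIndependent ℝ
      (fun (o : Option ι) x => o.elim (1 : ℝ) fun i => if x ∈ F i then (1 : ℝ) else 0) := by
    rw [Fintype.linearIndependent_iff]
    intro c hc
    have key := sum_sq_sum_indicator_add_const hk hm (fun i => c (some i)) (c none)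
    have h0 : ∀ x, ∑ i, c (some i) * (if x ∈ F i then (1 : ℝ) else 0) + c none = 0 := fun x => by
      simpa [Fintype.sum_option, add_comm] using congrFun hc x
    simp only [h0] at key
    have hpos : (0 : ℝ) < k - m := by simpa using hmk
    have hn : (0 : ℝ) < Fintype.card α := by exact_mod_cast hα
    have hkn : (k : ℝ) ^ 2 ≤ m * Fintype.card α := by exact_mod_cast hkα
    have hnn' : 0 ≤ ∑ i, c (some i) ^ 2 := Finset.sum_nonneg fun i _ => sq_nonneg _
    have hnn : 0 ≤ m * (∑ i, c (some i)) ^ 2 + 2 * c none * k * ∑ i, c (some i)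
        + c none ^ 2 * Fintype.card α := by
      -- With `s = ∑ c`, `d = c none`, `n = card α`, the form times `n` is `(k s + d n)² + (m n -
      -- k²) s²`.
      refine nonneg_of_mul_nonneg_right ?_ hn
      nlinarith [sq_nonneg (k * ∑ i, c (some i) + c none * Fintype.card α),
        mul_nonneg (sub_nonneg.2 hkn) (sq_nonneg (∑ i, c (some i)))]
    have hs : ∑ i, c (some i) ^ 2 = 0 := by
      simp only [ne_eq, OfNat.ofNat_ne_zero, not_false_eq_true, zero_pow,
        Finset.sum_const_zero] at key
      nlinarith [mul_nonneg hpos.le hnn']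
    have hsome : ∀ i, c (some i) = 0 := fun i => by
      simpa using (Finset.sum_eq_zero_iff_of_nonneg fun i _ => sq_nonneg (c (some i))).1 hs i
    have hnone : c none = 0 := by
      obtain ⟨x⟩ := Fintype.card_pos_iff.1 hα
      simpa [hsome] using h0 x
    rintro (_ | i)
    exacts [hnone, hsome i]
  have := hli.fintype_card_le_finrank
  simp at this
  omega

end Fisher

namespace OddGraphVertex

variable {ℓ : ℕ}

lemma card_sdiff_add_card_inter (A B : OddGraphVertex ℓ) :
    #(A.1 \ B.1) + #(A.1 ∩ B.1) = ℓ - 1 := by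
  rw [Finset.card_sdiff_add_card_inter, A.2]

lemma card_sdiff_comm (A B : OddGraphVertex ℓ) : #(A.1 \ B.1) = #(B.1 \ A.1) :=
  Finset.card_sdiff_comm (A.2.trans B.2.symm)

lemma exists_card_inter (hℓ : 2 ≤ ℓ) {i : ℕ} (hi : i ≤ ℓ - 1) :
    ∃ A B : OddGraphVertex ℓ, #(A.1 ∩ B.1) = i := by
  obtain ⟨A, -, hA⟩ := Finset.exists_subset_card_eq
    (s := (Finset.univ : Finset (Fin (2 * ℓ - 1)))) (n := ℓ - 1) (by simp; omega)
  obtain ⟨I, hIA, hI⟩ := Finset.exists_subset_card_eq (s := A) (n := i) (by omega)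
  obtain ⟨J, hJA, hJ⟩ := Finset.exists_subset_card_eq (s := Aᶜ) (n := ℓ - 1 - i)
    (by simp [Finset.card_compl]; omega)
  have hdisj : Disjoint A J := (Finset.subset_compl_iff_disjoint_left).1 hJA
  refine ⟨⟨A, hA⟩, ⟨I ∪ J, ?_⟩, ?_⟩
  · rw [Finset.card_union_of_disjoint (hdisj.mono_left hIA)]
    omega
  · change #(A ∩ (I ∪ J)) = i
    rw [Finset.inter_union_distrib_left, Finset.disjoint_iff_inter_eq_empty.1 hdisj,
      Finset.union_empty, Finset.inter_eq_right.2 hIA, hI]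

end OddGraphVertex

/-! ### Distances in the Odd graph -/

section OddGraph

open OddGraphVertex

variable {ℓ : ℕ}

lemma oddGraph_adj_of_disjoint (hℓ : 2 ≤ ℓ) {A B : OddGraphVertex ℓ} (h : Disjoint A.1 B.1) :
    (oddGraph ℓ).Adj A B := by
  refine ⟨?_, h⟩
  rintro rfl
  have h0 : A.1 = ∅ := Finset.disjoint_self_iff_empty _ |>.1 h
  have := A.2
  rw [h0] at this
  simp at this
  omega

/-- Two edges exchange `a ∈ A \ B` for `b ∈ B \ A`, through the complement of `A ∪ {b}`. -/
lemma oddGraph_edist_le_two_mul (hℓ : 2 ≤ ℓ) (j : ℕ) (A B : OddGraphVertex ℓ)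
    (h : #(A.1 \ B.1) ≤ j) : (oddGraph ℓ).edist A B ≤ (2 * j : ℕ) := by
  induction j generalizing A with
  | zero =>
    have hs : A.1 ⊆ B.1 := by
      rwa [Nat.le_zero, Finset.card_eq_zero, Finset.sdiff_eq_empty_iff_subset] at h
    have : A = B := Subtype.ext (Finset.eq_of_subset_of_card_le hs (by rw [A.2, B.2]))
    simp [this]
  | succ j ih =>
    rcases Nat.eq_zero_or_pos #(A.1 \ B.1) with h0 | h0
    · exact (ih A (by omega)).trans (by exact_mod_cast (by omega : 2 * j ≤ 2 * (j + 1)))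
    obtain ⟨a, ha⟩ := Finset.card_pos.1 h0
    obtain ⟨b, hb⟩ := Finset.card_pos.1 (card_sdiff_comm A B ▸ h0)
    rw [Finset.mem_sdiff] at ha hb
    have hcard : #(insert b (A.1.erase a)) = ℓ - 1 := by
      rw [Finset.card_insert_of_notMem (fun hh => hb.2 (Finset.mem_of_mem_erase hh)),
        Finset.card_erase_of_mem ha.1, A.2]
      omega
    let A' : OddGraphVertex ℓ := ⟨insert b (A.1.erase a), hcard⟩
    have hA' : A'.1 \ B.1 ⊆ (A.1 \ B.1).erase a := by
      intro x hx
      simp only [A', Finset.mem_sdiff, Finset.mem_insert, Finset.mem_erase] at hx ⊢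
      grind
    have hle : #(A'.1 \ B.1) ≤ j := by
      have := Finset.card_le_card hA'
      rw [Finset.card_erase_of_mem (Finset.mem_sdiff.2 ha)] at this
      omega
    have hC : #(insert b A.1)ᶜ = ℓ - 1 := by
      rw [Finset.card_compl, Finset.card_insert_of_notMem hb.2, A.2, Fintype.card_fin]
      omega
    let C : OddGraphVertex ℓ := ⟨(insert b A.1)ᶜ, hC⟩
    have h1 : (oddGraph ℓ).Adj A C := oddGraph_adj_of_disjoint hℓ
      (disjoint_compl_right.mono_left (Finset.subset_insert _ _))
    have h2 : (oddGraph ℓ).Adj C A' := oddGraph_adj_of_disjoint hℓ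
      (disjoint_compl_left.mono_right (Finset.insert_subset_insert _ (Finset.erase_subset _ _)))
    calc (oddGraph ℓ).edist A B ≤ (oddGraph ℓ).edist A C + ((oddGraph ℓ).edist C A' +
          (oddGraph ℓ).edist A' B) :=
          SimpleGraph.edist_triangle.trans (by gcongr; exact SimpleGraph.edist_triangle)
      _ ≤ 1 + (1 + (2 * j : ℕ)) := by
          gcongr
          · exact (SimpleGraph.edist_eq_one_iff_adj.2 h1).le
          · exact (SimpleGraph.edist_eq_one_iff_adj.2 h2).le
          · exact ih A' hle
      _ = (2 * (j + 1) : ℕ) := by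
          exact_mod_cast (by ring : 1 + (1 + 2 * j) = 2 * (j + 1))

/-- One edge leads to some `C` with `B \ A ⊆ C ⊆ Aᶜ`, which misses only points of `A ∩ B` from `B`.
-/
lemma oddGraph_edist_le_two_mul_add_one (hℓ : 2 ≤ ℓ) (A B : OddGraphVertex ℓ) :
    (oddGraph ℓ).edist A B ≤ (2 * #(A.1 ∩ B.1) + 1 : ℕ) := by
  obtain ⟨C, hBC, hCA, hC⟩ := Finset.exists_subsuperset_card_eq (s := B.1 \ A.1) (t := A.1ᶜ)
    (n := ℓ - 1) (fun x hx => by simp at hx ⊢; exact hx.2)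
    ((Finset.card_le_card Finset.sdiff_subset).trans B.2.le)
    (by rw [Finset.card_compl, A.2, Fintype.card_fin]; omega)
  have h1 : (oddGraph ℓ).Adj A ⟨C, hC⟩ := oddGraph_adj_of_disjoint hℓ
    (disjoint_compl_right.mono_right hCA)
  have h2 : #(C \ B.1) ≤ #(A.1 ∩ B.1) := by
    rw [card_sdiff_comm ⟨C, hC⟩ B]
    refine Finset.card_le_card fun x hx => ?_
    simp only [Finset.mem_sdiff, Finset.mem_inter] at hx ⊢
    refine ⟨by_contra fun h => hx.2 (hBC (Finset.mem_sdiff.2 ⟨hx.1, h⟩)), hx.1⟩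
  calc (oddGraph ℓ).edist A B ≤ (oddGraph ℓ).edist A ⟨C, hC⟩ + (oddGraph ℓ).edist ⟨C, hC⟩ B :=
        SimpleGraph.edist_triangle
    _ ≤ 1 + (2 * #(A.1 ∩ B.1) : ℕ) := by
        gcongr
        · exact (SimpleGraph.edist_eq_one_iff_adj.2 h1).le
        · exact oddGraph_edist_le_two_mul hℓ _ _ _ h2
    _ = (2 * #(A.1 ∩ B.1) + 1 : ℕ) := by rw [add_comm]; norm_cast

/-- Adjacent vertices are disjoint and cover all but one point, so each edge nearly swaps
intersection with difference. Needed only for the lower bound on the diameter. -/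
lemma oddGraph_walk_length_bound {A B : OddGraphVertex ℓ} (w : (oddGraph ℓ).Walk A B) :
    (Even w.length → 2 * #(A.1 \ B.1) ≤ w.length) ∧
      (Odd w.length → 2 * #(A.1 ∩ B.1) + 1 ≤ w.length) := by
  induction w with
  | nil => simp
  | @cons A C B h w ih =>
    rw [SimpleGraph.Walk.length_cons, Nat.even_add_one, Nat.odd_add_one, Nat.not_even_iff_odd,
      Nat.not_odd_iff_even]
    have e1 := card_sdiff_add_card_inter A B
    have e2 := card_sdiff_add_card_inter C B
    constructor
    · intro hodd
      have := ih.2 hodd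
      have hU : #(A.1 ∪ C.1) = 2 * (ℓ - 1) := by
        rw [Finset.card_union_of_disjoint h.2, A.2, C.2]; ring
      have hc : #(B.1 \ (A.1 ∪ C.1)) ≤ 1 := by
        refine (Finset.card_le_card (t := (A.1 ∪ C.1)ᶜ) fun x hx => ?_).trans ?_
        · simp at hx ⊢; exact hx.2
        · rw [Finset.card_compl, hU, Fintype.card_fin]; omega
      have hsub : #B.1 ≤ #(A.1 ∩ B.1) + #(C.1 ∩ B.1) + #(B.1 \ (A.1 ∪ C.1)) := by
        refine le_trans (Finset.card_le_card (t := A.1 ∩ B.1 ∪ C.1 ∩ B.1 ∪ B.1 \ (A.1 ∪ C.1))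
          fun x hx => ?_) ((Finset.card_union_le _ _).trans
            (Nat.add_le_add_right (Finset.card_union_le _ _) _))
        simp only [Finset.mem_union, Finset.mem_inter, Finset.mem_sdiff]
        tauto
      have := B.2
      omega
    · intro heven
      have := ih.1 heven
      have hsub : #(A.1 ∩ B.1) ≤ #(B.1 \ C.1) := by
        refine Finset.card_le_card fun x hx => ?_
        rw [Finset.mem_inter] at hx
        exact Finset.mem_sdiff.2 ⟨hx.2, Finset.disjoint_left.1 h.2 hx.1⟩
      rw [← card_sdiff_comm C B] at hsub
      omega

lemma oddGraph_ediam (hℓ : 2 ≤ ℓ) : (oddGraph ℓ).ediam = ((ℓ - 1 : ℕ) : ℕ∞) := by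
  apply le_antisymm
  · refine SimpleGraph.ediam_le_of_edist_le fun A B => ?_
    have e := card_sdiff_add_card_inter A B
    by_cases h : 2 * #(A.1 \ B.1) ≤ ℓ - 1
    · exact (oddGraph_edist_le_two_mul hℓ _ A B le_rfl).trans (by exact_mod_cast h)
    · exact (oddGraph_edist_le_two_mul_add_one hℓ A B).trans
        (by exact_mod_cast (by omega : 2 * #(A.1 ∩ B.1) + 1 ≤ ℓ - 1))
  · obtain ⟨A, B, hAB⟩ := exists_card_inter hℓ (Nat.div_le_self (ℓ - 1) 2)
    refine le_trans ?_ (SimpleGraph.edist_le_ediam (u := A) (v := B))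
    refine le_iInf fun w => ?_
    have e := card_sdiff_add_card_inter A B
    have hw := oddGraph_walk_length_bound w
    have : ℓ - 1 ≤ w.length := by
      rcases Nat.even_or_odd w.length with h | h
      · have := hw.1 h; omega
      · have := hw.2 h; omega
    exact_mod_cast this

lemma card_inter_of_lt_edist (hℓ : 2 ≤ ℓ) {A B : OddGraphVertex ℓ}
    (h : ((ℓ - 2 : ℕ) : ℕ∞) < (oddGraph ℓ).edist A B) : #(A.1 ∩ B.1) = (ℓ - 1) / 2 := by
  have h1 := h.trans_le (oddGraph_edist_le_two_mul hℓ _ A B le_rfl)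
  have h2 := h.trans_le (oddGraph_edist_le_two_mul_add_one hℓ A B)
  rw [Nat.cast_lt] at h1 h2
  have e := card_sdiff_add_card_inter A B
  omega

lemma card_inter_of_isKIndepSet (hℓ : 2 ≤ ℓ) {S : Finset (OddGraphVertex ℓ)}
    (hS : (oddGraph ℓ).IsKIndepSet (ℓ - 2) S) (A B : S) (hAB : A ≠ B) :
    #(A.1.1 ∩ B.1.1) = (ℓ - 1) / 2 :=
  card_inter_of_lt_edist hℓ (hS A A.2 B B.2 fun h => hAB (Subtype.ext h))

end OddGraph

lemma SimpleGraph.kIndepNum_le {V : Type*} [Fintype V] {G : SimpleGraph V} {k n : ℕ}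
    (h : ∀ S, G.IsKIndepSet k S → #S ≤ n) : G.kIndepNum k ≤ n := by
  classical
  exact Finset.sup_le fun S hS => h S (Finset.mem_filter.1 hS).2

theorem mainTheorem2 (ℓ : ℕ) (hℓ : 2 ≤ ℓ) :
    (oddGraph ℓ).ediam = ((ℓ - 1 : ℕ) : ℕ∞) ∧
      (Odd ℓ → (oddGraph ℓ).kIndepNum (ℓ - 2) ≤ 2 * ℓ - 2) ∧
      (Even ℓ → (oddGraph ℓ).kIndepNum (ℓ - 2) ≤ 2 * ℓ - 1) := by
  refine ⟨oddGraph_ediam hℓ, fun hodd => ?_, fun _ => ?_⟩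
  · refine SimpleGraph.kIndepNum_le fun S hS => ?_
    have h := card_lt_of_uniform_of_card_inter (F := fun A : S => A.1.1)
      (show (ℓ - 1) / 2 < ℓ - 1 by omega) (fun A => A.1.2) (card_inter_of_isKIndepSet hℓ hS)
      (by rw [Fintype.card_fin]; omega) (by
        -- Here `k = 2t`, `m = t` and there are `4t + 1` points: `4t² ≤ t(4t + 1)`.
        obtain ⟨t, rfl⟩ := hodd
        rw [Fintype.card_fin, show 2 * t + 1 - 1 = 2 * t by omega,
          show 2 * t / 2 = t by omega, show 2 * (2 * t + 1) - 1 = 4 * t + 1 by omega]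
        nlinarith)
    rw [Fintype.card_coe, Fintype.card_fin] at h
    omega
  · refine SimpleGraph.kIndepNum_le fun S hS => ?_
    have h := card_le_of_uniform_of_card_inter (F := fun A : S => A.1.1)
      (show (ℓ - 1) / 2 < ℓ - 1 by omega) (fun A => A.1.2) (card_inter_of_isKIndepSet hℓ hS)
    rwa [Fintype.card_coe, Fintype.card_fin] at h
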